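/- Let $m\ge 3$, let $L=\{p\in\mathbb{R}^m : p_i\ge 0,\ \sum_i p_i\le 1\}$ be the set of lotteries over the $m+1$ prospects $0,1,\dots,m$, and let $\mathcal{R}$ be the set of vN-M preferences on $L$, that is, of the weak orders $R$ on $L$ for which there is a utility $u\in\mathbb{R}^m$ with $x\,R\,y\iff u\cdot x\ge u\cdot y$ for all $x,y\in L$; write $\overline{R}$ for the strict part of $R$. Fix a lottery $\overline{x}\in L$ with $\overline{x}\ne 0$, let $\mathcal{R}_{\overline{x}}$ be the set of the $R\in\mathcal{R}$ with $\overline{x}\,\overline{R}\,0$, and for $R\in\mathcal{R}_{\overline{x}}$ let $u_H(R)$ be the unique utility of $R$ with $u_H(R)\cdot\overline{x}=1$. Let $X$ be a set of individuals with $|X|\ge 4$; a coalition is a nonempty finite subset of $X$. Let $\mathcal{R}_X$ be the set of profiles $R=(R_i)_{i\in X}\in\mathcal{R}_{\overline{x}}^X$ for which the points $u_H(R_i)$, $i\in X$, do not all lie on one line, and let $\mathcal{R}_X^*$ be the set of the restrictions $R_A=(R_i)_{i\in A}$ of profiles $R\in\mathcal{R}_X$ to coalitions $A$. A generalized social welfare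 function is a function $f:\mathcal{R}_X^*\to\mathcal{R}$ with $f(R_{\{i\}})=R_i$ for all $R\in\mathcal{R}_X$ and $i\in X$. It satisfies the extended Pareto property if for all $R\in\mathcal{R}_X$, all disjoint coalitions $A,B$ and all $x,y\in L$: if $x\,f(R_A)\,y$ and $x\,f(R_B)\,y$, then $x\,f(R_{A\cup B})\,y$; and if $x\,\overline{f(R_A)}\,y$ and $x\,f(R_B)\,y$, then $x\,\overline{f(R_{A\cup B})}\,y$. Theorem. A generalized social welfare function $f:\mathcal{R}_X^*\to\mathcal{R}$ satisfies the extended Pareto property if and only if there is a weight function $w:X\times\mathcal{R}_{\overline{x}}\to(0,\infty)$ such that, for every profile $R\in\mathcal{R}_X$ and every coalition $A$, one has $f(R_A)\in\mathcal{R}_{\overline{x}}$ and $$u_H(f(R_A))=\sum_{i\in A}\frac{w(i,R_i)}{\sum_{j\in A}w(j,R_j)}\,u_H(R_i).$$ Moreover, the weight function is unique up to multiplication by a positive number: if $w$ is such a weight function, then $w':X\times\mathcal{R}_{\overline{x}}\to\mathbb{R}$ is another one if and only if $w'=c\,w$ for some $c>0$. -/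

import Mathlib

open scoped Matrix

namespace SocialWelfare

/-- Lotteries over the prospects `0, 1, …, m`: the probabilities of the prospects `1, …, m` are
listed, and prospect `0` receives the remaining probability. -/
def Lottery (m : ℕ) : Type :=
  {p : Fin m → ℝ // (∀ i, 0 ≤ p i) ∧ ∑ i, p i ≤ 1}

/-- The lottery `0`, which gives prospect `0` for sure. -/
instance (m : ℕ) : Zero (Lottery m) :=
  ⟨⟨0, fun _ => le_rfl, by simp⟩⟩

/-- The vector `u ∈ ℝᵐ` is a utility of the relation `R` on lotteries. -/
def IsUtility {m : ℕ} (R : Lottery m → Lottery m → Prop) (u : Fin m → ℝ) : Prop :=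
  ∀ x y : Lottery m, R x y ↔ u ⬝ᵥ y.1 ≤ u ⬝ᵥ x.1

/-- vN-M preferences: weak orders on lotteries that have a linear utility
(normalized to be `0` at prospect `0`). -/
@[ext]
structure VNMPreference (m : ℕ) where
  /-- `rel x y`: the lottery `x` is weakly preferred to the lottery `y`. -/
  rel : Lottery m → Lottery m → Prop
  total : ∀ x y, rel x y ∨ rel y x
  trans : ∀ x y z, rel x y → rel y z → rel x z
  exists_utility : ∃ u : Fin m → ℝ, IsUtility rel u

/-- The strict part of a preference. -/
def VNMPreference.strict {m : ℕ} (R : VNMPreference m) (x y : Lottery m) : Prop :=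
  R.rel x y ∧ ¬ R.rel y x

/-- The vN-M preferences that strictly prefer `xbar` to the lottery `0`. -/
def Agreeing {m : ℕ} (xbar : Lottery m) : Type :=
  {R : VNMPreference m // R.strict xbar 0}

/-- A preference that strictly prefers `xbar` to `0` has exactly one utility with value `1` at
`xbar`. -/
theorem existsUnique_normalizedUtility {m : ℕ} {xbar : Lottery m} (R : Agreeing xbar) :
    ∃! u : Fin m → ℝ, IsUtility R.1.rel u ∧ u ⬝ᵥ xbar.1 = 1 := by
  obtain ⟨⟨r, -, -, u, hu⟩, h⟩ := R
  have h0 : ((0 : Lottery m).1) = (0 : Fin m → ℝ) := rfl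
  have hpos : 0 < u ⬝ᵥ xbar.1 := by
    have h2 : ¬ r 0 xbar := h.2
    rw [hu, h0, dotProduct_zero, not_le] at h2
    exact h2
  refine ⟨(u ⬝ᵥ xbar.1)⁻¹ • u, ⟨fun x y => ?_, ?_⟩, ?_⟩
  · change r x y ↔ _
    rw [hu x y, smul_dotProduct, smul_dotProduct, smul_eq_mul, smul_eq_mul,
      mul_le_mul_iff_right₀ (inv_pos.2 hpos)]
  · rw [smul_dotProduct, smul_eq_mul, inv_mul_cancel₀ hpos.ne']
  · rintro v ⟨hv, hv1⟩
    have hv : IsUtility r v := hv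
    -- lotteries that are indifferent for `u` are indifferent for `v`
    have key : ∀ a b : Lottery m, u ⬝ᵥ a.1 = u ⬝ᵥ b.1 → v ⬝ᵥ a.1 = v ⬝ᵥ b.1 := fun a b hab =>
      le_antisymm ((hv b a).1 ((hu b a).2 hab.le)) ((hv a b).1 ((hu a b).2 hab.ge))
    ext i
    set c := u ⬝ᵥ xbar.1 with hc
    -- a positive scale `δ` for which all the lotteries below exist
    set δ : ℝ := (1 + |u i / c|)⁻¹ with hδ
    have hδpos : 0 < δ := by positivity
    have hδle : δ * (1 + |u i / c|) = 1 := inv_mul_cancel₀ (by positivity)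
    have hδ1 : δ ≤ 1 := by nlinarith [abs_nonneg (u i / c)]
    have hδ2 : δ * |u i / c| ≤ 1 := by nlinarith
    have hsc : ∀ (t : ℝ) (a : Lottery m), 0 ≤ t → t ≤ 1 →
        (∀ j, 0 ≤ (t • a.1) j) ∧ ∑ j, (t • a.1) j ≤ 1 := by
      intro t a ht0 ht1
      refine ⟨fun j => mul_nonneg ht0 (a.2.1 j), ?_⟩
      have : ∑ j, (t • a.1) j = t * ∑ j, a.1 j := by simp [Finset.mul_sum]
      rw [this]
      nlinarith [a.2.2, Finset.sum_nonneg (fun j (_ : j ∈ Finset.univ) => a.2.1 j)]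
    let e : Lottery m := ⟨Pi.single i 1, fun j => by
      by_cases hj : j = i
      · subst hj; simp
      · simp [hj], by simp⟩
    have he : ∀ q : Fin m → ℝ, q ⬝ᵥ e.1 = q i := fun q => by simp [e]
    rcases le_total 0 (u i / c) with hs | hs
    · rw [abs_of_nonneg hs] at hδ2
      have := key ⟨δ • e.1, hsc δ e hδpos.le hδ1⟩
        ⟨(δ * (u i / c)) • xbar.1, hsc _ xbar (by positivity) hδ2⟩ (by
          simp only [dotProduct_smul, he, smul_eq_mul, ← hc]; field_simp)
      simp only [dotProduct_smul, he, smul_eq_mul, hv1, mul_one] at this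
      have := mul_left_cancel₀ hδpos.ne' this
      simp [this, div_eq_inv_mul]
    · rw [abs_of_nonpos hs] at hδ2 hδle
      -- mix `e` and `xbar` so that the mixture is indifferent to `0`
      have hm : (∀ j, 0 ≤ (δ • e.1 + (δ * -(u i / c)) • xbar.1) j) ∧
          ∑ j, (δ • e.1 + (δ * -(u i / c)) • xbar.1) j ≤ 1 := by
        have hk : 0 ≤ δ * -(u i / c) := mul_nonneg hδpos.le (by linarith)
        refine ⟨fun j => add_nonneg (mul_nonneg hδpos.le (e.2.1 j))
          (mul_nonneg hk (xbar.2.1 j)), ?_⟩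
        have : ∑ j, (δ • e.1 + (δ * -(u i / c)) • xbar.1) j
            = δ * ∑ j, e.1 j + (δ * -(u i / c)) * ∑ j, xbar.1 j := by
          simp [Finset.sum_add_distrib, Finset.mul_sum]
        rw [this]
        have h1 := mul_le_mul_of_nonneg_left e.2.2 hδpos.le
        have h2 := mul_le_mul_of_nonneg_left xbar.2.2 hk
        linarith
      have := key ⟨_, hm⟩ 0 (by
          simp only [dotProduct_add, dotProduct_smul, he, smul_eq_mul, ← hc, h0, dotProduct_zero]
          field_simp; ring)
      simp only [dotProduct_add, dotProduct_smul, he, smul_eq_mul, hv1, mul_one, h0,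
        dotProduct_zero] at this
      have : δ * v i = δ * (u i / c) := by linarith
      have := mul_left_cancel₀ hδpos.ne' this
      simp [this, div_eq_inv_mul]

/-- The map `u_H`: the unique utility of the preference with value `1` at `xbar`. -/
noncomputable def uH {m : ℕ} {xbar : Lottery m} (R : Agreeing xbar) : Fin m → ℝ :=
  (existsUnique_normalizedUtility R).choose

/-- The profiles whose normalized utilities do not all lie on one line, that is, span an affine
subspace of dimension greater than one. -/
def Profile (X : Type*) {m : ℕ} (xbar : Lottery m) : Type _ :=
  {R : X → Agreeing xbar // ¬ Collinear ℝ (Set.range fun i => uH (R i))}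

/-- The domain of generalized social welfare functions: the restrictions of noncollinear
profiles to nonempty finite coalitions. -/
structure SubProfile (X : Type*) {m : ℕ} (xbar : Lottery m) where
  coalition : Finset X
  nonempty : coalition.Nonempty
  pref : coalition → Agreeing xbar
  extends_to : ∃ R : Profile X xbar, ∀ i : coalition, pref i = R.1 i

/-- The restriction `R_A` of the profile `R` to the coalition `A`. -/
def Profile.restrict {X : Type*} {m : ℕ} {xbar : Lottery m} (R : Profile X xbar)
    (A : Finset X) (hA : A.Nonempty) : SubProfile X xbar :=
  ⟨A, hA, fun i => R.1 i, R, fun _ => rfl⟩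

/-- Generalized social welfare functions: every sub-profile gets a vN-M preference, and a single
individual gets that individual's own preference. -/
structure GSWF (X : Type*) {m : ℕ} (xbar : Lottery m) where
  toFun : SubProfile X xbar → VNMPreference m
  individualism : ∀ (R : Profile X xbar) (i : X),
    toFun (R.restrict {i} (Finset.singleton_nonempty i)) = (R.1 i).1

/-- The extended Pareto property. -/
def GSWF.ExtendedPareto {X : Type*} [DecidableEq X] {m : ℕ} {xbar : Lottery m}
    (f : GSWF X xbar) : Prop :=
  ∀ (R : Profile X xbar) (A B : Finset X) (hA : A.Nonempty) (hB : B.Nonempty), Disjoint A B →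
    ∀ x y : Lottery m,
      ((f.toFun (R.restrict A hA)).rel x y → (f.toFun (R.restrict B hB)).rel x y →
        (f.toFun (R.restrict (A ∪ B) (hA.mono Finset.subset_union_left))).rel x y) ∧
      ((f.toFun (R.restrict A hA)).strict x y → (f.toFun (R.restrict B hB)).rel x y →
        (f.toFun (R.restrict (A ∪ B) (hA.mono Finset.subset_union_left))).strict x y)

/-- `w` is a strictly positive weight function and, for every noncollinear profile `R` and every
coalition `A`, the preference `f(R_A)` strictly prefers `xbar` to `0` and `u_H(f(R_A))` is the
weighted average, with the weights `w(i, R_i)`, of the `u_H(R_i)`, `i ∈ A`. -/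
def GSWF.IsWeight {X : Type*} {m : ℕ} {xbar : Lottery m}
    (f : GSWF X xbar) (w : X × Agreeing xbar → ℝ) : Prop :=
  (∀ p, 0 < w p) ∧
  ∀ (R : Profile X xbar) (A : Finset X) (hA : A.Nonempty),
    ∃ h : (f.toFun (R.restrict A hA)).strict xbar 0,
      uH ⟨f.toFun (R.restrict A hA), h⟩ =
        ∑ i ∈ A, (w (i, R.1 i) / ∑ j ∈ A, w (j, R.1 j)) • uH (R.1 i)

end SocialWelfare

/-! On normalized utilities, the Pareto property for two disjoint coalitions says exactly that the
point of the union lies in the open segment between the points of the parts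
(`pareto_iff_mem_openSegment`). Weighted centers of mass behave this way, which gives one direction
of the equivalence.

Conversely, two individuals with different preferences determine a ratio, in which their common
point divides the segment between their utilities; it depends on the two pairs (individual,
preference) only. In a triangle the point of three individuals lies on three cevians, so by Ceva the
ratios around it multiply to 1 (`IsSegmental.ratio_mul`). A fourth individual off the line extends
this to collinear triples. The ratios thus form a multiplicative cocycle, hence are quotients of
weights (`exists_weight_of_cocycle`), and an induction that uses noncollinearity carries the formula
from pairs to all coalitions (`IsSegmental.eq_centerMass`). Pairs also determine the weights up to a
common factor. -/

namespace SocialWelfare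

/-! ### Aggregation by segments in a real vector space -/

section Segments

variable {V : Type*} [AddCommGroup V] [Module ℝ V]

theorem exists_smul_of_mem_openSegment {x y q z : V} (hq : q ∈ openSegment ℝ x y)
    (hz : z ∈ openSegment ℝ x y) (hne : q ≠ z) :
    (∃ c : ℝ, x = z + c • (q - z)) ∧ ∃ c : ℝ, y = z + c • (q - z) := by
  obtain ⟨s, s', hs, hs', hss, rfl⟩ := hq
  obtain ⟨t, t', ht, ht', htt, rfl⟩ := hz
  obtain rfl : s' = 1 - s := by linarith
  obtain rfl : t' = 1 - t := by linarith
  have hst : s - t ≠ 0 := by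
    intro h
    obtain rfl : s = t := by linarith
    exact hne rfl
  refine ⟨⟨(1 - t) / (s - t), ?_⟩, ⟨-t / (s - t), ?_⟩⟩
  · match_scalars <;> field_simp <;> ring
  · match_scalars <;> field_simp <;> ring

/-- `q` aggregates the points `u i`: the point of a disjoint union lies strictly between the points
of the two parts. -/
structure IsSegmental {X : Type*} [DecidableEq X] (u : X → V) (q : Finset X → V) : Prop where
  singleton : ∀ i, q {i} = u i
  union : ∀ A B : Finset X, A.Nonempty → B.Nonempty → Disjoint A B →
    q (A ∪ B) ∈ openSegment ℝ (q A) (q B)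

variable {X : Type*} [DecidableEq X] {u : X → V} {q : Finset X → V} {w : X → ℝ}

theorem centerMass_union_mem_openSegment (hw : ∀ i, 0 < w i) {A B : Finset X} (hA : A.Nonempty)
    (hB : B.Nonempty) (hAB : Disjoint A B) :
    (A ∪ B).centerMass w u ∈ openSegment ℝ (A.centerMass w u) (B.centerMass w u) := by
  have hWA : 0 < ∑ i ∈ A, w i := Finset.sum_pos (fun i _ => hw i) hA
  have hWB : 0 < ∑ i ∈ B, w i := Finset.sum_pos (fun i _ => hw i) hB
  refine ⟨(∑ i ∈ A, w i) / (∑ i ∈ A, w i + ∑ i ∈ B, w i),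
    (∑ i ∈ B, w i) / (∑ i ∈ A, w i + ∑ i ∈ B, w i), by positivity, by positivity, by field_simp, ?_⟩
  simp only [Finset.centerMass, Finset.sum_union hAB]
  match_scalars <;> field_simp

theorem IsSegmental.pair_mem (h : IsSegmental u q) {i j : X} (hij : i ≠ j) :
    q {i, j} ∈ openSegment ℝ (u i) (u j) := by
  have := h.union {i} {j} (Finset.singleton_nonempty i) (Finset.singleton_nonempty j)
    (Finset.disjoint_singleton.2 hij)
  rwa [h.singleton, h.singleton] at this

/-- In a minimal counterexample `A`, the distinct points `q A` and `z` put all members of `A` on one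
line. An individual `l` off this line exists by noncollinearity, and adding `l` to `A` forces `u l`
back onto it. -/
theorem IsSegmental.eq_centerMass (h : IsSegmental u q) (hw : ∀ i, 0 < w i)
    (hpair : ∀ i j, i ≠ j → (w i + w j) • q {i, j} = w i • u i + w j • u j)
    (hnc : ¬ Collinear ℝ (Set.range u)) {A : Finset X} (hA : A.Nonempty) :
    q A = A.centerMass w u := by
  have hsing : ∀ i, ({i} : Finset X).centerMass w u = u i := fun i =>
    Finset.centerMass_singleton _ _ (hw i).ne'
  induction A using Finset.strongInduction with
  | H A ih =>
  by_contra hne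
  set z := A.centerMass w u with hz
  set e := q A - z with he
  have he0 : e ≠ 0 := sub_ne_zero.2 hne
  have herase : ∀ i ∈ A, (A.erase i).Nonempty := by
    intro i hi
    rw [Finset.nonempty_iff_ne_empty]
    intro h0
    have : A = {i} := by rw [← Finset.insert_erase hi, h0]; rfl
    apply hne
    rw [hz, this, h.singleton, hsing]
  have hqe : ∀ i ∈ A, q (A.erase i) = (A.erase i).centerMass w u := fun i hi =>
    ih _ (Finset.erase_ssubset hi) (herase i hi)
  have hu : ∀ i ∈ A, A.erase i ∪ {i} = A := fun i hi => by
    rw [Finset.union_comm]; exact Finset.insert_erase hi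
  have hd : ∀ i, Disjoint (A.erase i) {i} := fun i => by simp
  -- By induction `q A` and `z` lie in the same open segment, from the center of mass of `A.erase i`
  -- to `u i`; being distinct, they span its line.
  have hline : ∀ i ∈ A, (∃ c : ℝ, (A.erase i).centerMass w u = z + c • e) ∧
      ∃ c : ℝ, u i = z + c • e := by
    intro i hi
    have h1 := h.union _ _ (herase i hi) (Finset.singleton_nonempty i) (hd i)
    have h2 := centerMass_union_mem_openSegment (u := u) hw (herase i hi)
      (Finset.singleton_nonempty i) (hd i)
    rw [hu i hi, hqe i hi, h.singleton] at h1
    rw [hu i hi, hsing] at h2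
    exact exists_smul_of_mem_openSegment h1 h2 hne
  -- somebody is off the line
  obtain ⟨l, hl⟩ : ∃ l, ∀ c : ℝ, u l ≠ z + c • e := by
    by_contra! hc
    apply hnc
    rw [collinear_iff_exists_forall_eq_smul_vadd]
    refine ⟨z, e, ?_⟩
    rintro _ ⟨l, rfl⟩
    obtain ⟨c, hc⟩ := hc l
    exact ⟨c, by rw [hc, vadd_eq_add, add_comm]⟩
  have hlA : l ∉ A := fun hmem => by
    obtain ⟨c, hc⟩ := (hline l hmem).2
    exact hl c hc
  have hdl : Disjoint A {l} := by simpa using hlA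
  have hzD := centerMass_union_mem_openSegment (u := u) hw hA (Finset.singleton_nonempty l) hdl
  have hqD := h.union _ _ hA (Finset.singleton_nonempty l) hdl
  rw [hsing, ← hz] at hzD
  rw [h.singleton] at hqD
  -- If the two points agree, the segments from `q A` and from `z` to `u l` meet in their interiors,
  -- which puts `u l` on the line through `q A` and `z`.
  by_cases hD : q (A ∪ {l}) = (A ∪ {l}).centerMass w u
  · rw [hD] at hqD
    obtain ⟨s, s', hs, hs', hss, h1⟩ := hqD
    obtain ⟨t, t', ht, ht', htt, h2⟩ := hzD
    obtain rfl : s' = 1 - s := by linarith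
    obtain rfl : t' = 1 - t := by linarith
    have h3 : s • e = (s - t) • (u l - z) := by
      have : s • q A = t • z + (1 - t) • u l - (1 - s) • u l := by rw [h2, ← h1]; abel
      rw [he, smul_sub, this]
      module
    have hst : s - t ≠ 0 := by
      intro h0
      rw [h0, zero_smul] at h3
      exact he0 ((smul_eq_zero.1 h3).resolve_left hs.ne')
    apply hl (s / (s - t))
    have : (s / (s - t)) • e = u l - z := by
      rw [div_eq_inv_mul, mul_smul, h3, smul_smul, inv_mul_cancel₀ hst, one_smul]
    rw [this]; abel
  · set zD := (A ∪ {l}).centerMass w u with hzD'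
    set d := q (A ∪ {l}) - zD with hd'
    -- Splitting `A ∪ {l}` into `A.erase i` and `{i, l}`, where `q` is known on both parts, puts
    -- every center of mass of `A.erase i` on a second line, through `zD`.
    have hlineD : ∀ i ∈ A, ∃ c : ℝ, (A.erase i).centerMass w u = zD + c • d := by
      intro i hi
      have hil : i ≠ l := fun h0 => hlA (h0 ▸ hi)
      have hdis : Disjoint (A.erase i) {i, l} := by
        rw [Finset.disjoint_left]
        intro a ha ha'
        rw [Finset.mem_insert, Finset.mem_singleton] at ha'
        rcases ha' with rfl | rfl
        · exact Finset.notMem_erase _ _ ha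
        · exact hlA (Finset.mem_of_mem_erase ha)
      have hun : A.erase i ∪ {i, l} = A ∪ {l} := by
        ext a
        by_cases hai : a = i
        · subst hai; simp [hi]
        · simp [hai]
      have hne' : ({i, l} : Finset X).Nonempty := Finset.insert_nonempty _ _
      have h1 := h.union _ _ (herase i hi) hne' hdis
      have h2 := centerMass_union_mem_openSegment (u := u) hw (herase i hi) hne' hdis
      have hq2 : q {i, l} = ({i, l} : Finset X).centerMass w u := by
        rw [Finset.centerMass, Finset.sum_pair hil, Finset.sum_pair hil, ← hpair i l hil,
          smul_smul, inv_mul_cancel₀ (add_pos (hw i) (hw l)).ne', one_smul]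
      rw [hun, hqe i hi, hq2] at h1
      rw [hun] at h2
      exact (exists_smul_of_mem_openSegment h1 h2 hD).1
    choose! b hb using fun i hi => (hline i hi).1
    choose! c hc using fun i hi => (hline i hi).2
    have hrel : ∀ i ∈ A, (∑ j ∈ A.erase i, w j) * b i + w i * c i = 0 := by
      intro i hi
      have hWe : 0 < ∑ j ∈ A.erase i, w j := Finset.sum_pos (fun i _ => hw i) (herase i hi)
      have hWA : 0 < ∑ j ∈ A, w j := Finset.sum_pos (fun i _ => hw i) hA
      have e1 : (∑ j ∈ A.erase i, w j) • (A.erase i).centerMass w u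
          = ∑ j ∈ A.erase i, w j • u j := by
        rw [Finset.centerMass, smul_smul, mul_inv_cancel₀ hWe.ne', one_smul]
      have e2 : (∑ j ∈ A, w j) • z = ∑ j ∈ A, w j • u j := by
        rw [hz, Finset.centerMass, smul_smul, mul_inv_cancel₀ hWA.ne', one_smul]
      rw [← Finset.sum_erase_add _ _ hi, ← Finset.sum_erase_add _ _ hi, ← e1, hb i hi,
        hc i hi] at e2
      have : ((∑ j ∈ A.erase i, w j) * b i + w i * c i) • e = 0 := by
        rw [← sub_eq_zero] at e2
        rw [← neg_eq_zero, ← e2]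
        module
      exact (smul_eq_zero.1 this).resolve_right he0
    have hsum : ∑ i ∈ A, w i * c i = 0 := by
      have hWA : 0 < ∑ j ∈ A, w j := Finset.sum_pos (fun i _ => hw i) hA
      have e2 : (∑ j ∈ A, w j) • z = ∑ j ∈ A, w j • u j := by
        rw [hz, Finset.centerMass, smul_smul, mul_inv_cancel₀ hWA.ne', one_smul]
      have e3 : ∑ j ∈ A, w j • u j = (∑ j ∈ A, w j) • z + (∑ j ∈ A, w j * c j) • e := by
        rw [Finset.sum_smul, Finset.sum_smul, ← Finset.sum_add_distrib]
        exact Finset.sum_congr rfl fun j hj => by rw [hc j hj]; module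
      rw [e2] at e3
      exact (smul_eq_zero.1 (left_eq_add.1 e3)).resolve_right he0
    -- If `c i = 0`, then `b i = 0` and the segment containing `q A` degenerates to `z`.
    have hcne : ∀ i ∈ A, c i ≠ 0 := by
      intro i hi h0
      have hr := hrel i hi
      rw [h0, mul_zero, add_zero] at hr
      have hWe : 0 < ∑ j ∈ A.erase i, w j := Finset.sum_pos (fun i _ => hw i) (herase i hi)
      have hb0 : b i = 0 := (mul_eq_zero.1 hr).resolve_left hWe.ne'
      have h1 := h.union _ _ (herase i hi) (Finset.singleton_nonempty i) (hd i)
      rw [hu i hi, hqe i hi, h.singleton, hb i hi, hc i hi, h0, hb0, openSegment_same] at h1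
      apply hne
      rw [Set.mem_singleton_iff.1 h1, zero_smul, add_zero]
    -- The nonzero `w i * c i` sum to 0, so both signs occur. By `hrel` two of the centers of mass
    -- then lie on opposite sides of `z`; they are distinct and on both lines, so the lines
    -- coincide.
    obtain ⟨k, hk⟩ := hA
    have hknz : w k * c k ≠ 0 := mul_ne_zero (hw k).ne' (hcne k hk)
    obtain ⟨i, hi, hi0⟩ := Finset.exists_pos_of_sum_zero_of_exists_nonzero _ hsum ⟨k, hk, hknz⟩
    obtain ⟨j, hj, hj0⟩ := Finset.exists_pos_of_sum_zero_of_exists_nonzero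
      (fun i => -(w i * c i)) (by rw [Finset.sum_neg_distrib, hsum, neg_zero])
      ⟨k, hk, neg_ne_zero.2 hknz⟩
    have hbi : b i < 0 := by
      have hWe : 0 < ∑ j ∈ A.erase i, w j := Finset.sum_pos (fun i _ => hw i) (herase i hi)
      have := hrel i hi
      by_contra! hcon
      nlinarith [mul_nonneg hWe.le hcon]
    have hbj : 0 < b j := by
      have hWe : 0 < ∑ k ∈ A.erase j, w k := Finset.sum_pos (fun i _ => hw i) (herase j hj)
      have := hrel j hj
      by_contra! hcon
      nlinarith [mul_nonneg hWe.le (neg_nonneg.2 hcon)]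
    obtain ⟨c₁, h₁⟩ := hlineD i hi
    obtain ⟨c₂, h₂⟩ := hlineD j hj
    rw [hb i hi] at h₁
    rw [hb j hj] at h₂
    have h3 : (b j - b i) • e = (c₂ - c₁) • d := by
      have : (z + b j • e) - (z + b i • e) = (zD + c₂ • d) - (zD + c₁ • d) := by rw [h₁, h₂]
      calc _ = (z + b j • e) - (z + b i • e) := by module
        _ = _ := by rw [this]; module
    have hcc : c₂ - c₁ ≠ 0 := by
      intro h0
      rw [h0, zero_smul] at h3
      exact he0 ((smul_eq_zero.1 h3).resolve_left (by linarith))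
    have hde : d = ((b j - b i) / (c₂ - c₁)) • e := by
      rw [div_eq_inv_mul, mul_smul, h3, smul_smul, inv_mul_cancel₀ hcc, one_smul]
    obtain ⟨t, t', ht, ht', htt, h2⟩ := hzD
    obtain rfl : t' = 1 - t := by linarith
    set κ := (b j - b i) / (c₂ - c₁)
    -- Now `zD` is on the first line, and so is `u l`, since `zD` lies strictly between `z` and `u
    -- l`.
    have h4 : zD = z + (b i - c₁ * κ) • e := by
      rw [hde] at h₁
      rw [eq_sub_of_add_eq h₁.symm]
      module
    have h5 : (1 - t) • u l = (1 - t) • (z + ((1 - t)⁻¹ * (b i - c₁ * κ)) • e) := by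
      rw [eq_sub_of_add_eq' h2, h4, smul_add, smul_smul, mul_inv_cancel_left₀ ht'.ne']
      module
    exact hl _ (smul_right_injective V ht'.ne' h5)

theorem eq_zero_of_not_collinear {x y z : V} (h : ¬ Collinear ℝ {x, y, z}) {a b c : ℝ}
    (hs : a + b + c = 0) (h0 : a • x + b • y + c • z = 0) : a = 0 ∧ b = 0 ∧ c = 0 := by
  rw [← affineIndependent_iff_not_collinear_set, affineIndependent_iff] at h
  have := h Finset.univ ![a, b, c] (by simp [Fin.sum_univ_three, hs])
    (by simp [Fin.sum_univ_three, h0])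
  exact ⟨this 0 (Finset.mem_univ _), this 1 (Finset.mem_univ _), this 2 (Finset.mem_univ _)⟩

/-- Ceva's theorem for the three ratios of a triangle. -/
theorem IsSegmental.ratio_mul (h : IsSegmental u q) {i j k : X} (hij : i ≠ j) (hjk : j ≠ k)
    (hki : k ≠ i) (hnc : ¬ Collinear ℝ {u i, u j, u k}) {ρ σ τ : ℝ} (hρ : 0 < ρ) (hσ : 0 < σ)
    (hτ : 0 < τ) (h₁ : (1 + ρ) • q {i, j} = ρ • u i + u j)
    (h₂ : (1 + σ) • q {j, k} = σ • u j + u k) (h₃ : (1 + τ) • q {k, i} = τ • u k + u i) :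
    ρ * σ * τ = 1 := by
  -- Each cevian fixes the ratio of two barycentric coordinates of `q {i, j, k}`; comparing the
  -- three expressions uses uniqueness of these coordinates.
  have aux : ∀ a b c : X, a ≠ b → b ≠ c → c ≠ a → ({a, b, c} : Finset X) = {i, j, k} → ∀ r : ℝ,
      0 < r → (1 + r) • q {a, b} = r • u a + u b → ∃ s : ℝ, 0 < s ∧ s * (r + 1) < 1 ∧
        q {i, j, k} = (s * r) • u a + s • u b + (1 - s * (r + 1)) • u c := by
    intro a b c hab hbc hca hset r hr hq
    have hun : ({a, b} ∪ {c} : Finset X) = {i, j, k} := by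
      rw [← hset]; ext; simp
    have hdis : Disjoint ({a, b} : Finset X) {c} := by
      simp [hca, hbc.symm]
    obtain ⟨s, s', hs, hs', hss, hq'⟩ := h.union {a, b} {c} (Finset.insert_nonempty _ _)
      (Finset.singleton_nonempty c) hdis
    obtain rfl : s' = 1 - s := by linarith
    rw [hun, h.singleton] at hq'
    have hr1 : (1 + r) ≠ 0 := by positivity
    have hqab : q {a, b} = (1 + r)⁻¹ • (r • u a + u b) := by
      rw [← hq, smul_smul, inv_mul_cancel₀ hr1, one_smul]
    have hsr : s / (1 + r) * (r + 1) = s := by field_simp; ring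
    refine ⟨s / (1 + r), by positivity, by linarith, ?_⟩
    rw [← hq', hqab, hsr]
    module
  obtain ⟨s₁, hs₁, hs₁', e₁⟩ := aux i j k hij hjk hki rfl ρ hρ h₁
  obtain ⟨s₂, hs₂, hs₂', e₂⟩ := aux j k i hjk hki hij (by ext; simp; tauto) σ hσ h₂
  obtain ⟨s₃, hs₃, hs₃', e₃⟩ := aux k i j hki hij hjk (by ext; simp; tauto) τ hτ h₃
  have c₁ := eq_zero_of_not_collinear hnc
    (a := s₁ * ρ - (1 - s₂ * (σ + 1))) (b := s₁ - s₂ * σ) (c := 1 - s₁ * (ρ + 1) - s₂) (by ring) (by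
      rw [e₁, ← sub_eq_zero] at e₂
      rw [← e₂]; module)
  have c₂ := eq_zero_of_not_collinear hnc
    (a := s₁ * ρ - s₃) (b := s₁ - (1 - s₃ * (τ + 1))) (c := 1 - s₁ * (ρ + 1) - s₃ * τ) (by ring) (by
      rw [e₁, ← sub_eq_zero] at e₃
      rw [← e₃]; module)
  have f₁ : s₁ = s₂ * σ := by linarith [c₁.2.1]
  have f₂ : s₁ * ρ = s₃ := by linarith [c₂.1]
  have f₃ : s₂ = s₃ * τ := by linarith [c₁.2.2, c₂.2.2]
  have : s₁ * (ρ * σ * τ) = s₁ * 1 := by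
    calc s₁ * (ρ * σ * τ) = (s₁ * ρ) * τ * σ := by ring
      _ = s₁ * 1 := by rw [f₂, ← f₃, ← f₁, mul_one]
  exact mul_left_cancel₀ hs₁.ne' this

end Segments

/-! ### Cocycles on transversal pairs -/

section Coboundary

variable {X P : Type*}

/-- Two pairs are in general position if they differ in both coordinates. -/
def Transversal (a b : X × P) : Prop := a.1 ≠ b.1 ∧ a.2 ≠ b.2

theorem Transversal.symm {a b : X × P} (h : Transversal a b) : Transversal b a :=
  ⟨h.1.symm, h.2.symm⟩

theorem exists_ne_of_card (hX : 4 ≤ ENat.card X) (i j k : X) : ∃ l, l ≠ i ∧ l ≠ j ∧ l ≠ k := by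
  classical
  by_contra! hc
  have hs : (Set.univ : Set X) ⊆ ({i, j, k} : Finset X) := by
    intro l _
    by_cases h1 : l = i
    · simp [h1]
    by_cases h2 : l = j
    · simp [h2]
    simp [hc l h1 h2]
  have h1 := Set.encard_le_encard hs
  rw [Set.encard_univ, Set.encard_coe_eq_coe_finsetCard] at h1
  have h2 : ((({i, j, k} : Finset X).card : ℕ) : ℕ∞) ≤ (3 : ℕ) := by
    exact_mod_cast Finset.card_le_three
  have h3 := (hX.trans h1).trans h2
  exact absurd h3 (by decide)

theorem exists_ne_of_infinite [Infinite P] (p q r s : P) : ∃ t, t ≠ p ∧ t ≠ q ∧ t ≠ r ∧ t ≠ s := by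
  classical
  obtain ⟨t, ht⟩ := Infinite.exists_notMem_finset ({p, q, r, s} : Finset P)
  simp only [Finset.mem_insert, Finset.mem_singleton, not_or] at ht
  exact ⟨t, ht⟩

theorem exists_transversal_three [Infinite P] (hX : 4 ≤ ENat.card X) (a b c : X × P) :
    ∃ d, Transversal a d ∧ Transversal b d ∧ Transversal c d := by
  obtain ⟨l, h1, h2, h3⟩ := exists_ne_of_card hX a.1 b.1 c.1
  obtain ⟨t, g1, g2, g3, -⟩ := exists_ne_of_infinite a.2 b.2 c.2 c.2
  exact ⟨(l, t), ⟨h1.symm, g1.symm⟩, ⟨h2.symm, g2.symm⟩, ⟨h3.symm, g3.symm⟩⟩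

/-- A positive multiplicative cocycle on transversal pairs is a coboundary. -/
theorem exists_weight_of_cocycle [Infinite P] (hX : 4 ≤ ENat.card X) (r : X × P → X × P → ℝ)
    (hpos : ∀ a b, Transversal a b → 0 < r a b)
    (hanti : ∀ a b, Transversal a b → r a b * r b a = 1)
    (htri : ∀ a b c, Transversal a b → Transversal b c → Transversal c a →
      r a b * r b c * r c a = 1) :
    ∃ w : X × P → ℝ, (∀ a, 0 < w a) ∧ ∀ a b, Transversal a b → w a = r a b * w b := by
  have htri' : ∀ a b c, Transversal a b → Transversal b c → Transversal a c →
      r a c = r a b * r b c := fun a b c hab hbc hac => by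
    have h1 := htri a b c hab hbc hac.symm
    have h2 := hanti a c hac
    have h3 := (hpos c a hac.symm).ne'
    apply mul_right_cancel₀ h3
    rw [h1, h2]
  -- the composite of two steps does not depend on the intermediate pair
  have hadj : ∀ a b c d, Transversal a c → Transversal c b → Transversal a d → Transversal d b →
      Transversal c d → r a c * r c b = r a d * r d b := fun a b c d hac hcb had hdb hcd => by
    rw [htri' a c d hac hcd had, htri' c d b hcd hdb hcb]; ring
  -- With a common first coordinate, `c` and `d` are compared through a pair transversal to all of
  -- `a`, `b`, `c`, `d`; its individual must avoid three others, hence at least four individuals.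
  have hfst : ∀ a b c d, Transversal a c → Transversal c b → Transversal a d → Transversal d b →
      c.1 = d.1 → r a c * r c b = r a d * r d b := fun a b c d hac hcb had hdb hcd => by
    obtain ⟨l, h1, h2, h3⟩ := exists_ne_of_card hX a.1 b.1 c.1
    obtain ⟨t, g1, g2, g3, g4⟩ := exists_ne_of_infinite a.2 b.2 c.2 d.2
    have hae : Transversal a (l, t) := ⟨h1.symm, g1.symm⟩
    have heb : Transversal (l, t) b := ⟨h2, g2⟩
    rw [hadj a b c (l, t) hac hcb hae heb ⟨h3.symm, g3.symm⟩,
      hadj a b (l, t) d hae heb had hdb ⟨hcd ▸ h3, g4⟩]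
  have hindep : ∀ a b c d, Transversal a c → Transversal c b → Transversal a d →
      Transversal d b → r a c * r c b = r a d * r d b := fun a b c d hac hcb had hdb => by
    by_cases hcd : c.1 = d.1
    · exact hfst a b c d hac hcb had hdb hcd
    obtain ⟨t, g1, g2, g3, g4⟩ := exists_ne_of_infinite a.2 b.2 c.2 d.2
    have hae : Transversal a (d.1, t) := ⟨had.1, g1.symm⟩
    have heb : Transversal (d.1, t) b := ⟨hdb.1, g2⟩
    rw [hadj a b c (d.1, t) hac hcb hae heb ⟨hcd, g3.symm⟩,
      hfst a b (d.1, t) d hae heb had hdb rfl]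
  obtain ⟨i₀⟩ : Nonempty X := by
    rw [← not_isEmpty_iff]
    intro h
    rw [ENat.card_eq_zero_iff_empty _ |>.2 h] at hX
    exact absurd hX (by decide)
  obtain ⟨p₀⟩ : Nonempty P := inferInstance
  -- A weight relative to the base pair needs two steps, because `a` need not be transversal to the
  -- base.
  choose m hm₁ hm₂ _ using fun a => exists_transversal_three hX a (i₀, p₀) (i₀, p₀)
  refine ⟨fun a => r a (m a) * r (m a) (i₀, p₀), fun a =>
    mul_pos (hpos _ _ (hm₁ a)) (hpos _ _ (hm₂ a).symm), fun a b hab => ?_⟩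
  obtain ⟨d, h1, h2, h3⟩ := exists_transversal_three hX a b (i₀, p₀)
  dsimp only
  rw [hindep a _ (m a) d (hm₁ a) (hm₂ a).symm h1 h3.symm,
    hindep b _ (m b) d (hm₁ b) (hm₂ b).symm h2 h3.symm, htri' a b d hab h2 h1, mul_assoc]

end Coboundary

/-! ### Geometry of normalized utilities -/

section Preferences

variable {m : ℕ} {xbar : Lottery m}

theorem uH_isUtility (R : Agreeing xbar) : IsUtility R.1.rel (uH R) :=
  (existsUnique_normalizedUtility R).choose_spec.1.1

theorem uH_dotProduct (R : Agreeing xbar) : uH R ⬝ᵥ xbar.1 = 1 :=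
  (existsUnique_normalizedUtility R).choose_spec.1.2

theorem strict_iff_uH (R : Agreeing xbar) (x y : Lottery m) :
    R.1.strict x y ↔ uH R ⬝ᵥ y.1 < uH R ⬝ᵥ x.1 := by
  rw [VNMPreference.strict, uH_isUtility R x y, uH_isUtility R y x, not_le]
  exact ⟨fun h => h.2, fun h => ⟨h.le, h⟩⟩

theorem uH_injective : Function.Injective (uH : Agreeing xbar → Fin m → ℝ) := by
  intro R S h
  apply Subtype.ext
  apply VNMPreference.ext
  funext x y
  rw [eq_iff_iff, uH_isUtility R x y, uH_isUtility S x y, h]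

/-- Every vector with value `1` at `xbar` is a normalized utility. -/
theorem exists_uH_eq (u : Fin m → ℝ) (hu : u ⬝ᵥ xbar.1 = 1) : ∃ R : Agreeing xbar, uH R = u := by
  have h0 : ((0 : Lottery m).1) = (0 : Fin m → ℝ) := rfl
  let R : Agreeing xbar := ⟨⟨fun x y => u ⬝ᵥ y.1 ≤ u ⬝ᵥ x.1, fun x y => le_total _ _,
    fun x y z h₁ h₂ => h₂.trans h₁, u, fun x y => Iff.rfl⟩, by
      simp [VNMPreference.strict, h0, hu]⟩
  exact ⟨R, (existsUnique_normalizedUtility R).unique ⟨uH_isUtility R, uH_dotProduct R⟩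
    ⟨fun x y => Iff.rfl, hu⟩⟩

/-- Every vector is a positive multiple of a difference of lotteries. -/
theorem exists_lottery_sub (d : Fin m → ℝ) :
    ∃ (x y : Lottery m) (δ : ℝ), 0 < δ ∧ x.1 - y.1 = δ • d := by
  -- Dividing the positive and negative parts of `d` by this number makes both lotteries; the
  -- summand 1 covers `d = 0`.
  have hN : 0 < 1 + ∑ j, |d j| := by positivity
  have key : ∀ g : Fin m → ℝ, (∀ j, 0 ≤ g j) → (∀ j, g j ≤ |d j|) →
      (∀ j, 0 ≤ ((1 + ∑ j, |d j|)⁻¹ • g) j) ∧ ∑ j, ((1 + ∑ j, |d j|)⁻¹ • g) j ≤ 1 := by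
    intro g hg hgd
    refine ⟨fun j => mul_nonneg (by positivity) (hg j), ?_⟩
    simp only [Pi.smul_apply, smul_eq_mul]
    rw [← Finset.mul_sum, inv_mul_le_one₀ hN]
    linarith [Finset.sum_le_sum fun j (_ : j ∈ Finset.univ) => hgd j]
  refine ⟨⟨_, key (fun j => max (d j) 0) (fun j => le_max_right _ _)
    fun j => max_le (le_abs_self _) (abs_nonneg _)⟩,
    ⟨_, key (fun j => max (-d j) 0) (fun j => le_max_right _ _)
    fun j => max_le (neg_le_abs _) (abs_nonneg _)⟩, _, inv_pos.2 hN, ?_⟩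
  rw [← smul_sub]
  congr 1
  funext j
  rcases le_total (d j) 0 with h | h <;> simp [h]

/-- The Pareto property for two preferences means that the normalized utility of the aggregate
lies strictly between the two normalized utilities. -/
theorem pareto_iff_mem_openSegment (R S T : Agreeing xbar) :
    (∀ x y, (R.1.rel x y → S.1.rel x y → T.1.rel x y) ∧
      (R.1.strict x y → S.1.rel x y → T.1.strict x y) ∧
      (R.1.rel x y → S.1.strict x y → T.1.strict x y)) ↔
    uH T ∈ openSegment ℝ (uH R) (uH S) := by
  have hR := uH_dotProduct R
  have hS := uH_dotProduct S
  have hT := uH_dotProduct T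
  simp only [strict_iff_uH, uH_isUtility R _ _, uH_isUtility S _ _, uH_isUtility T _ _]
  generalize uH R = u at *
  generalize uH S = v at *
  generalize uH T = z at *
  constructor
  · intro h
    have hd : ∀ d : Fin m → ℝ, (0 ≤ u ⬝ᵥ d → 0 ≤ v ⬝ᵥ d → 0 ≤ z ⬝ᵥ d) ∧
        (0 < u ⬝ᵥ d → 0 ≤ v ⬝ᵥ d → 0 < z ⬝ᵥ d) ∧ (0 ≤ u ⬝ᵥ d → 0 < v ⬝ᵥ d → 0 < z ⬝ᵥ d) := by
      intro d
      obtain ⟨x, y, δ, hδ, hxy⟩ := exists_lottery_sub d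
      have hle : ∀ a : Fin m → ℝ, a ⬝ᵥ y.1 ≤ a ⬝ᵥ x.1 ↔ 0 ≤ a ⬝ᵥ d := fun a => by
        rw [← sub_nonneg, ← dotProduct_sub, hxy, dotProduct_smul, smul_eq_mul,
          mul_nonneg_iff_of_pos_left hδ]
      have hlt : ∀ a : Fin m → ℝ, a ⬝ᵥ y.1 < a ⬝ᵥ x.1 ↔ 0 < a ⬝ᵥ d := fun a => by
        rw [← sub_pos, ← dotProduct_sub, hxy, dotProduct_smul, smul_eq_mul,
          mul_pos_iff_of_pos_left hδ]
      simpa only [hle, hlt] using h x y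
    have hker : ∀ d : Fin m → ℝ, u ⬝ᵥ d = 0 → v ⬝ᵥ d = 0 → z ⬝ᵥ d = 0 := by
      intro d hu hv
      have h1 := (hd d).1 hu.ge hv.ge
      have h2 := (hd (-d)).1 (by simp [hu]) (by simp [hv])
      rw [dotProduct_neg] at h2
      linarith
    by_cases huv : u = v
    · subst huv
      rw [openSegment_same, Set.mem_singleton_iff]
      refine dotProduct_eq _ _ fun d => ?_
      have h1 := hker (d - (u ⬝ᵥ d) • xbar.1) (by simp [hR]) (by simp [hR])
      simp only [dotProduct_sub, dotProduct_smul, hT, smul_eq_mul, mul_one] at h1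
      linarith
    · obtain ⟨d₀, hd₀⟩ : ∃ d, u ⬝ᵥ d ≠ v ⬝ᵥ d := by
        by_contra! hc
        exact huv (dotProduct_eq _ _ hc)
      have hne : u ⬝ᵥ d₀ - v ⬝ᵥ d₀ ≠ 0 := sub_ne_zero.2 hd₀
      -- The vectors `d₁` and `xbar.1 - d₁` are dual to `u`, `v`. The values of `z` on them are the
      -- coefficients of `z`: positive by strict Pareto, with sum `z ⬝ᵥ xbar.1 = 1`.
      obtain ⟨d₁, hu₁, hv₁⟩ : ∃ d₁, u ⬝ᵥ d₁ = 1 ∧ v ⬝ᵥ d₁ = 0 := by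
        refine ⟨(u ⬝ᵥ d₀ - v ⬝ᵥ d₀)⁻¹ • (d₀ - (v ⬝ᵥ d₀) • xbar.1), ?_, ?_⟩
        · simp only [dotProduct_sub, dotProduct_smul, hR, smul_eq_mul, mul_one]
          exact inv_mul_cancel₀ hne
        · simp only [dotProduct_sub, dotProduct_smul, hS, smul_eq_mul, mul_one, sub_self,
            mul_zero]
      have hu₂ : u ⬝ᵥ (xbar.1 - d₁) = 0 := by rw [dotProduct_sub, hR, hu₁, sub_self]
      have hv₂ : v ⬝ᵥ (xbar.1 - d₁) = 1 := by rw [dotProduct_sub, hS, hv₁, sub_zero]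
      refine ⟨z ⬝ᵥ d₁, z ⬝ᵥ (xbar.1 - d₁), (hd _).2.1 (by simp [hu₁]) hv₁.ge,
        (hd _).2.2 hu₂.ge (by simp [hv₂]), by rw [dotProduct_sub, hT]; ring,
        dotProduct_eq _ _ fun d => ?_⟩
      have h1 := hker (d - (u ⬝ᵥ d) • d₁ - (v ⬝ᵥ d) • (xbar.1 - d₁))
        (by rw [dotProduct_sub, dotProduct_sub, dotProduct_smul _ _ d₁, dotProduct_smul, hu₁, hu₂]; simp)
        (by rw [dotProduct_sub, dotProduct_sub, dotProduct_smul _ _ d₁, dotProduct_smul, hv₁, hv₂]; simp)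
      rw [dotProduct_sub, dotProduct_sub, dotProduct_smul _ _ d₁, dotProduct_smul,
        smul_eq_mul, smul_eq_mul] at h1
      rw [add_dotProduct, smul_dotProduct, smul_dotProduct, smul_eq_mul, smul_eq_mul]
      linarith
  · rintro ⟨s, t, hs, ht, -, rfl⟩ x y
    simp only [add_dotProduct, smul_dotProduct, smul_eq_mul]
    refine ⟨fun h₁ h₂ => ?_, fun h₁ h₂ => ?_, fun h₁ h₂ => ?_⟩
    · gcongr
    · exact add_lt_add_of_lt_of_le (mul_lt_mul_of_pos_left h₁ hs)
        (mul_le_mul_of_nonneg_left h₂ ht.le)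
    · exact add_lt_add_of_le_of_lt (mul_le_mul_of_nonneg_left h₁ hs.le)
        (mul_lt_mul_of_pos_left h₂ ht)

/-- In at least three dimensions the normalized utilities do not lie on one line. -/
theorem exists_uH_notMem_line (hm : 3 ≤ m) (p q : Agreeing xbar) :
    ∃ t : Agreeing xbar, uH t ∉ line[ℝ, uH p, uH q] := by
  let φ : (Fin m → ℝ) →ₗ[ℝ] ℝ := (dotProductBilin ℝ ℝ).flip xbar.1
  have hφ : ∀ u, φ u = u ⬝ᵥ xbar.1 := fun u => rfl
  have hrank := φ.finrank_range_add_finrank_ker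
  have h1 : Module.finrank ℝ (LinearMap.range φ) ≤ 1 := by
    simpa using Submodule.finrank_le (LinearMap.range φ)
  rw [Module.finrank_fin_fun] at hrank
  -- Normalized utilities form a hyperplane whose direction `ker φ` has dimension at least `m - 1 ≥
  -- 2`, too large for one line.
  obtain ⟨e, he, hes⟩ : ∃ e ∈ LinearMap.ker φ, e ∉ Submodule.span ℝ {uH q - uH p} := by
    by_contra! hc
    have h2 := Submodule.finrank_mono (show LinearMap.ker φ ≤ Submodule.span ℝ {uH q - uH p} from hc)
    have h3 := finrank_span_le_card (R := ℝ) ({uH q - uH p} : Set (Fin m → ℝ))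
    rw [Set.toFinset_singleton, Finset.card_singleton] at h3
    omega
  rw [LinearMap.mem_ker, hφ] at he
  obtain ⟨t, ht⟩ := exists_uH_eq (xbar := xbar) (uH p + e) (by
    rw [add_dotProduct, he, uH_dotProduct, add_zero])
  refine ⟨t, fun hmem => hes ?_⟩
  rw [ht, add_comm, ← vadd_eq_add, vadd_left_mem_affineSpan_pair] at hmem
  exact Submodule.mem_span_singleton.2 hmem

theorem nonempty_agreeing (hxbar : xbar ≠ 0) : Nonempty (Agreeing xbar) := by
  have h : xbar.1 ⬝ᵥ xbar.1 ≠ 0 := fun h0 =>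
    hxbar (Subtype.ext (dotProduct_self_eq_zero.1 h0))
  obtain ⟨R, -⟩ := exists_uH_eq (xbar := xbar) ((xbar.1 ⬝ᵥ xbar.1)⁻¹ • xbar.1) (by
    rw [smul_dotProduct, smul_eq_mul, inv_mul_cancel₀ h])
  exact ⟨R⟩

theorem infinite_agreeing (hm : 3 ≤ m) (hxbar : xbar ≠ 0) : Infinite (Agreeing xbar) := by
  obtain ⟨p⟩ := nonempty_agreeing hxbar
  obtain ⟨q, hq⟩ := exists_uH_notMem_line hm p p
  have hne : uH q - uH p ≠ 0 := fun h => hq (by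
    rw [sub_eq_zero.1 h]; exact left_mem_affineSpan_pair ℝ _ _)
  choose g hg using fun r : ℝ => exists_uH_eq (xbar := xbar) (uH p + r • (uH q - uH p)) (by
    simp [add_dotProduct, smul_dotProduct, sub_dotProduct, uH_dotProduct])
  refine Infinite.of_injective g fun r s hrs => ?_
  have := congrArg uH hrs
  rw [hg, hg] at this
  exact smul_left_injective ℝ hne (add_left_cancel this)

theorem not_collinear_of_notMem_line {V : Type*} [AddCommGroup V] [Module ℝ V] {x y z : V}
    (hxy : x ≠ y) (h : z ∉ line[ℝ, x, y]) : ¬ Collinear ℝ {x, y, z} := fun hc =>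
  h (hc.mem_affineSpan_of_mem_of_ne (by simp) (by simp) (by simp) hxy)

end Preferences

/-! ### Social welfare functions and their weights -/

section Aggregation

variable {X : Type*} {m : ℕ} {xbar : Lottery m}

theorem exists_profile {i j k : X} (hij : i ≠ j) (hjk : j ≠ k) (hki : k ≠ i)
    {p q s : Agreeing xbar} (h : ¬ Collinear ℝ {uH p, uH q, uH s}) :
    ∃ R : Profile X xbar, R.1 i = p ∧ R.1 j = q ∧ R.1 k = s := by
  classical
  let R : X → Agreeing xbar := fun l => if l = i then p else if l = j then q else s
  have hi : R i = p := if_pos rfl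
  have hj : R j = q := by simp [R, hij.symm]
  have hk : R k = s := by simp [R, hki, hjk.symm]
  refine ⟨⟨R, fun hc => h (hc.subset ?_)⟩, hi, hj, hk⟩
  rintro _ (rfl | rfl | rfl)
  exacts [⟨i, by simp only [hi]⟩, ⟨j, by simp only [hj]⟩, ⟨k, by simp only [hk]⟩]

theorem exists_profile_pair (hX : 4 ≤ ENat.card X) (hm : 3 ≤ m) {a b : X × Agreeing xbar}
    (hab : Transversal a b) : ∃ R : Profile X xbar, R.1 a.1 = a.2 ∧ R.1 b.1 = b.2 := by
  obtain ⟨k, hka, hkb, -⟩ := exists_ne_of_card hX a.1 b.1 b.1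
  obtain ⟨t, ht⟩ := exists_uH_notMem_line hm a.2 b.2
  obtain ⟨R, h₁, h₂, -⟩ := exists_profile hab.1 hkb.symm hka
    (not_collinear_of_notMem_line (uH_injective.ne hab.2) ht)
  exact ⟨R, h₁, h₂⟩

theorem restrict_congr {R S : Profile X xbar} {A : Finset X} (hA : A.Nonempty)
    (h : ∀ i ∈ A, R.1 i = S.1 i) : R.restrict A hA = S.restrict A hA := by
  have : (fun i : A => R.1 i) = fun i : A => S.1 i := funext fun i => h i i.2
  simp only [Profile.restrict, this]

open Classical in
/-- The normalized utility of the preference of a coalition. -/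
noncomputable def GSWF.point (f : GSWF X xbar)
    (hf : ∀ (R : Profile X xbar) (A : Finset X) (hA : A.Nonempty),
      (f.toFun (R.restrict A hA)).strict xbar 0) (R : Profile X xbar) (A : Finset X) :
    Fin m → ℝ :=
  -- The value at the empty set is arbitrary: segmentality concerns nonempty sets only.
  if hA : A.Nonempty then uH ⟨f.toFun (R.restrict A hA), hf R A hA⟩ else 0

section Point

variable {f : GSWF X xbar} {hf : ∀ (R : Profile X xbar) (A : Finset X) (hA : A.Nonempty),
  (f.toFun (R.restrict A hA)).strict xbar 0}

theorem GSWF.point_of_nonempty (R : Profile X xbar) {A : Finset X} (hA : A.Nonempty) :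
    f.point hf R A = uH ⟨f.toFun (R.restrict A hA), hf R A hA⟩ := dif_pos hA

theorem GSWF.point_congr {R S : Profile X xbar} {A : Finset X}
    (h : ∀ i ∈ A, R.1 i = S.1 i) : f.point hf R A = f.point hf S A := by
  unfold GSWF.point
  split_ifs with hA
  · congr 2
    rw [restrict_congr hA h]
  · rfl

theorem GSWF.point_singleton (R : Profile X xbar) (i : X) : f.point hf R {i} = uH (R.1 i) := by
  rw [GSWF.point_of_nonempty R (Finset.singleton_nonempty i)]
  congr 1
  exact Subtype.ext (f.individualism R i)

end Point

theorem GSWF.IsWeight.const_mul {f : GSWF X xbar} {w w' : X × Agreeing xbar → ℝ}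
    (h : f.IsWeight w) {c : ℝ} (hc : 0 < c) (hw' : ∀ p, w' p = c * w p) : f.IsWeight w' := by
  refine ⟨fun p => by rw [hw']; exact mul_pos hc (h.1 p), fun R A hA => ?_⟩
  obtain ⟨hs, he⟩ := h.2 R A hA
  refine ⟨hs, he.trans (Finset.sum_congr rfl fun i _ => ?_)⟩
  simp only [hw', ← Finset.mul_sum]
  rw [mul_div_mul_left _ _ hc.ne']

variable [DecidableEq X]

/-- Every individual strictly prefers `xbar` to 0, and Pareto preserves this as members are added
one by one. -/
theorem GSWF.ExtendedPareto.strict_restrict {f : GSWF X xbar} (hf : f.ExtendedPareto)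
    (R : Profile X xbar) (A : Finset X) (hA : A.Nonempty) :
    (f.toFun (R.restrict A hA)).strict xbar 0 := by
  induction hA using Finset.Nonempty.cons_induction with
  | singleton i => rw [f.individualism]; exact (R.1 i).2
  | cons i B hi hB ih =>
    have h1 := (hf R {i} B (Finset.singleton_nonempty i) hB
      (Finset.disjoint_singleton_left.2 hi) xbar 0).2
      (by rw [f.individualism]; exact (R.1 i).2) ih.1
    simpa only [Finset.cons_eq_insert, Finset.insert_eq] using h1

theorem GSWF.ExtendedPareto.isSegmental {f : GSWF X xbar} (h : f.ExtendedPareto)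
    (R : Profile X xbar) : IsSegmental (fun i => uH (R.1 i)) (f.point h.strict_restrict R) where
  singleton i := GSWF.point_singleton R i
  union A B hA hB hAB := by
    rw [GSWF.point_of_nonempty R hA, GSWF.point_of_nonempty R hB,
      GSWF.point_of_nonempty R (hA.mono Finset.subset_union_left)]
    refine (pareto_iff_mem_openSegment _ _ _).1 fun x y => ?_
    refine ⟨(h R A B hA hB hAB x y).1, (h R A B hA hB hAB x y).2, fun h₁ h₂ => ?_⟩
    have := (h R B A hB hA hAB.symm x y).2 h₂ h₁
    simpa only [Finset.union_comm B A] using this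

theorem GSWF.IsWeight.extendedPareto {f : GSWF X xbar} {w : X × Agreeing xbar → ℝ}
    (h : f.IsWeight w) : f.ExtendedPareto := by
  intro R A B hA hB hAB
  have hcm : ∀ (A : Finset X) (hA : A.Nonempty) (hs : (f.toFun (R.restrict A hA)).strict xbar 0),
      uH ⟨f.toFun (R.restrict A hA), hs⟩
        = A.centerMass (fun i => w (i, R.1 i)) fun i => uH (R.1 i) := by
    intro A hA hs
    obtain ⟨_, he⟩ := h.2 R A hA
    rw [he, Finset.centerMass, Finset.smul_sum]
    exact Finset.sum_congr rfl fun i _ => by rw [smul_smul, div_eq_inv_mul]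
  have hmem := centerMass_union_mem_openSegment (u := fun i => uH (R.1 i))
    (fun i => h.1 (i, R.1 i)) hA hB hAB
  have hAB' := hA.mono (Finset.subset_union_left (s₂ := B))
  rw [← hcm A hA (h.2 R A hA).1, ← hcm B hB (h.2 R B hB).1, ← hcm _ hAB' (h.2 R _ hAB').1] at hmem
  have hmem := (pareto_iff_mem_openSegment _ _ _).2 hmem
  exact fun x y => ⟨(hmem x y).1, (hmem x y).2.1⟩

theorem GSWF.ExtendedPareto.exists_isWeight (hX : 4 ≤ ENat.card X) (hm : 3 ≤ m) (hxbar : xbar ≠ 0)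
    {f : GSWF X xbar} (hf : f.ExtendedPareto) : ∃ w : X × Agreeing xbar → ℝ, f.IsWeight w := by
  have := infinite_agreeing hm hxbar
  -- The ratio is read off from one profile and serves for all, since `f` sees only the restriction
  -- to the two individuals.
  have hex : ∀ a b : X × Agreeing xbar, Transversal a b → ∃ ρ : ℝ, 0 < ρ ∧
      ∀ R : Profile X xbar, R.1 a.1 = a.2 → R.1 b.1 = b.2 →
        (1 + ρ) • f.point hf.strict_restrict R {a.1, b.1} = ρ • uH a.2 + uH b.2 := by
    intro a b hab
    obtain ⟨R, hRa, hRb⟩ := exists_profile_pair hX hm hab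
    obtain ⟨s, t, hs, ht, hst, h⟩ := (hf.isSegmental R).pair_mem hab.1
    refine ⟨s / t, by positivity, fun S hSa hSb => ?_⟩
    rw [GSWF.point_congr (S := R) (by
      intro i hi
      rw [Finset.mem_insert, Finset.mem_singleton] at hi
      rcases hi with rfl | rfl
      exacts [hSa.trans hRa.symm, hSb.trans hRb.symm]), ← h, hRa, hRb]
    obtain rfl : s = 1 - t := by linarith
    match_scalars <;> field_simp <;> ring
  choose! r hpos hr using hex
  have hanti : ∀ a b, Transversal a b → r a b * r b a = 1 := by
    intro a b hab
    obtain ⟨R, hRa, hRb⟩ := exists_profile_pair hX hm hab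
    have h₁ := hr a b hab R hRa hRb
    have h₂ := hr b a hab.symm R hRb hRa
    rw [Finset.pair_comm] at h₂
    have p₁ := hpos a b hab
    have p₂ := hpos b a hab.symm
    have h₃ : (1 - r a b * r b a) • (uH a.2 - uH b.2) = 0 := by
      have : (1 + r b a) • (r a b • uH a.2 + uH b.2)
          = (1 + r a b) • (r b a • uH b.2 + uH a.2) := by
        rw [← h₁, ← h₂, smul_comm]
      rw [← sub_eq_zero] at this
      rw [← neg_eq_zero, ← this]
      module
    have h₄ := (smul_eq_zero.1 h₃).resolve_right (sub_ne_zero.2 (uH_injective.ne hab.2))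
    linarith
  have htri : ∀ a b c, Transversal a b → Transversal b c → Transversal c a →
      ¬ Collinear ℝ {uH a.2, uH b.2, uH c.2} → r a b * r b c * r c a = 1 := by
    intro a b c hab hbc hca hnc
    obtain ⟨R, hRa, hRb, hRc⟩ := exists_profile hab.1 hbc.1 hca.1 hnc
    apply (hf.isSegmental R).ratio_mul hab.1 hbc.1 hca.1 _ (hpos _ _ hab) (hpos _ _ hbc)
      (hpos _ _ hca)
    · simpa only [hRa, hRb] using hr a b hab R hRa hRb
    · simpa only [hRb, hRc] using hr b c hbc R hRb hRc
    · simpa only [hRc, hRa] using hr c a hca R hRc hRa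
    · simpa only [hRa, hRb, hRc] using hnc
  have htri' : ∀ a b c, Transversal a b → Transversal b c → Transversal c a →
      r a b * r b c * r c a = 1 := by
    intro a b c hab hbc hca
    by_cases hcol : Collinear ℝ {uH a.2, uH b.2, uH c.2}
    -- A fourth individual with utility off the line forms a genuine triangle with each side; in the
    -- product of the three Ceva relations the ratios involving `(l, t)` cancel by `hanti`.
    · obtain ⟨l, hla, hlb, hlc⟩ := exists_ne_of_card hX a.1 b.1 c.1
      obtain ⟨t, ht⟩ := exists_uH_notMem_line hm a.2 b.2
      have hab' := uH_injective.ne hab.2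
      have hbc' := uH_injective.ne hbc.2
      have hca' := uH_injective.ne hca.2
      have e₁ := hcol.affineSpan_eq_of_ne (p₁ := uH a.2) (p₂ := uH b.2) (by simp) (by simp) hab'
      have e₂ := hcol.affineSpan_eq_of_ne (p₁ := uH b.2) (p₂ := uH c.2) (by simp) (by simp) hbc'
      have e₃ := hcol.affineSpan_eq_of_ne (p₁ := uH c.2) (p₂ := uH a.2) (by simp) (by simp) hca'
      have ht₂ : uH t ∉ line[ℝ, uH b.2, uH c.2] := by rwa [e₂, ← e₁]
      have ht₃ : uH t ∉ line[ℝ, uH c.2, uH a.2] := by rwa [e₃, ← e₁]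
      have hda : Transversal (l, t) a := ⟨hla, fun h => ht (by
        have h : t = a.2 := h
        rw [h]; exact left_mem_affineSpan_pair ℝ _ _)⟩
      have hdb : Transversal (l, t) b := ⟨hlb, fun h => ht₂ (by
        have h : t = b.2 := h
        rw [h]; exact left_mem_affineSpan_pair ℝ _ _)⟩
      have hdc : Transversal (l, t) c := ⟨hlc, fun h => ht₃ (by
        have h : t = c.2 := h
        rw [h]; exact left_mem_affineSpan_pair ℝ _ _)⟩
      have f₁ := htri a b (l, t) hab hdb.symm hda (not_collinear_of_notMem_line hab' ht)
      have f₂ := htri b c (l, t) hbc hdc.symm hdb (not_collinear_of_notMem_line hbc' ht₂)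
      have f₃ := htri c a (l, t) hca hda.symm hdc (not_collinear_of_notMem_line hca' ht₃)
      have g₁ := hanti _ _ hda
      have g₂ := hanti _ _ hdb
      have g₃ := hanti _ _ hdc
      calc r a b * r b c * r c a = (r a b * r b c * r c a) * (r (l, t) a * r a (l, t)) *
            (r (l, t) b * r b (l, t)) * (r (l, t) c * r c (l, t)) := by
            rw [g₁, g₂, g₃]; ring
        _ = (r a b * r b (l, t) * r (l, t) a) * (r b c * r c (l, t) * r (l, t) b) *
            (r c a * r a (l, t) * r (l, t) c) := by ring
        _ = 1 := by rw [f₁, f₂, f₃]; ring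
    · exact htri a b c hab hbc hca hcol
  obtain ⟨w, hw, hwr⟩ := exists_weight_of_cocycle hX r hpos hanti htri'
  refine ⟨w, hw, fun R A hA => ⟨hf.strict_restrict R A hA, ?_⟩⟩
  have hpair : ∀ i j, i ≠ j → (w (i, R.1 i) + w (j, R.1 j)) •
      f.point hf.strict_restrict R {i, j}
        = w (i, R.1 i) • uH (R.1 i) + w (j, R.1 j) • uH (R.1 j) := by
    intro i j hij
    -- Equal preferences make the pair nontransversal, but then the segment is a single point and
    -- any weights work.
    by_cases hR : R.1 i = R.1 j
    · have hmem := (hf.isSegmental R).pair_mem hij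
      simp only [hR, openSegment_same, Set.mem_singleton_iff] at hmem
      rw [hR, hmem, add_smul]
    · have hT : Transversal (i, R.1 i) (j, R.1 j) := ⟨hij, hR⟩
      have h := hr _ _ hT R rfl rfl
      dsimp only at h
      rw [hwr _ _ hT]
      calc _ = w (j, R.1 j) • ((1 + r (i, R.1 i) (j, R.1 j)) •
            f.point hf.strict_restrict R {i, j}) := by module
        _ = _ := by rw [h]; module
  have := (hf.isSegmental R).eq_centerMass (fun i => hw (i, R.1 i)) hpair R.2 hA
  rw [← GSWF.point_of_nonempty (hf := hf.strict_restrict) R hA, this, Finset.centerMass,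
    Finset.smul_sum]
  exact Finset.sum_congr rfl fun i _ => by rw [smul_smul, div_eq_inv_mul]

/-- Both weight functions describe the same point between two distinct utilities, so its
coefficients, and hence the weight ratios, agree. -/
theorem GSWF.IsWeight.mul_comm_of_transversal (hX : 4 ≤ ENat.card X) (hm : 3 ≤ m)
    {f : GSWF X xbar} {w w' : X × Agreeing xbar → ℝ} (h : f.IsWeight w) (h' : f.IsWeight w')
    {a b : X × Agreeing xbar} (hab : Transversal a b) : w' a * w b = w' b * w a := by
  obtain ⟨R, hRa, hRb⟩ := exists_profile_pair hX hm hab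
  obtain ⟨hs, he⟩ := h.2 R {a.1, b.1} (Finset.insert_nonempty _ _)
  obtain ⟨_, he'⟩ := h'.2 R {a.1, b.1} (Finset.insert_nonempty _ _)
  rw [he] at he'
  simp only [Finset.sum_pair hab.1, hRa, hRb] at he'
  have hwa := h.1 a
  have hwb := h.1 b
  have hwa' := h'.1 a
  have hwb' := h'.1 b
  have h₀ : (w a / (w a + w b) - w' a / (w' a + w' b)) • (uH a.2 - uH b.2) = 0 := by
    have e₁ : w b / (w a + w b) = 1 - w a / (w a + w b) := by field_simp; ring
    have e₂ : w' b / (w' a + w' b) = 1 - w' a / (w' a + w' b) := by field_simp; ring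
    rw [e₁, e₂, ← sub_eq_zero] at he'
    rw [← he']
    module
  have h₁ := (smul_eq_zero.1 h₀).resolve_right (sub_ne_zero.2 (uH_injective.ne hab.2))
  rw [sub_eq_zero, div_eq_div_iff (by positivity) (by positivity)] at h₁
  linarith

theorem GSWF.IsWeight.eq_const_mul (hX : 4 ≤ ENat.card X) (hm : 3 ≤ m) (hxbar : xbar ≠ 0)
    {f : GSWF X xbar} {w w' : X × Agreeing xbar → ℝ} (h : f.IsWeight w) (h' : f.IsWeight w') :
    ∃ c : ℝ, 0 < c ∧ ∀ p, w' p = c * w p := by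
  have := infinite_agreeing hm hxbar
  obtain ⟨i₀⟩ : Nonempty X := by
    rw [← not_isEmpty_iff]
    intro hE
    rw [ENat.card_eq_zero_iff_empty _ |>.2 hE] at hX
    exact absurd hX (by decide)
  obtain ⟨p₀⟩ : Nonempty (Agreeing xbar) := inferInstance
  refine ⟨w' (i₀, p₀) / w (i₀, p₀), div_pos (h'.1 _) (h.1 _), fun a => ?_⟩
  -- The pair `a` need not be transversal to the base pair, so the two are compared through `d`.
  obtain ⟨d, h₁, h₂, -⟩ := exists_transversal_three hX a (i₀, p₀) (i₀, p₀)
  have e₁ := h.mul_comm_of_transversal hX hm h' h₁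
  have e₂ := h.mul_comm_of_transversal hX hm h' h₂
  have n₀ := (h.1 (i₀, p₀)).ne'
  have nd := (h.1 d).ne'
  rw [div_mul_eq_mul_div, eq_div_iff n₀]
  apply mul_right_cancel₀ nd
  calc w' a * w (i₀, p₀) * w d = (w' a * w d) * w (i₀, p₀) := by ring
    _ = (w' d * w (i₀, p₀)) * w a := by rw [e₁]; ring
    _ = _ := by rw [← e₂]; ring

end Aggregation

end SocialWelfare

theorem theorem6 {X : Type*} [DecidableEq X] (hX : 4 ≤ ENat.card X) {m : ℕ} (hm : 3 ≤ m)
    (xbar : SocialWelfare.Lottery m) (hxbar : xbar ≠ 0) (f : SocialWelfare.GSWF X xbar) :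
    (f.ExtendedPareto ↔ ∃ w : X × SocialWelfare.Agreeing xbar → ℝ, f.IsWeight w) ∧
    ∀ w : X × SocialWelfare.Agreeing xbar → ℝ, f.IsWeight w →
      ∀ w' : X × SocialWelfare.Agreeing xbar → ℝ,
        f.IsWeight w' ↔ ∃ c : ℝ, 0 < c ∧ ∀ p, w' p = c * w p :=
  ⟨⟨fun h => h.exists_isWeight hX hm hxbar, fun ⟨_, h⟩ => h.extendedPareto⟩,
    fun _ h _ => ⟨fun h' => h.eq_const_mul hX hm hxbar h', fun ⟨_, hc, hw'⟩ => h.const_mul hc hw'⟩⟩
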